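/- Let $n\ge 1$ and let $\mathbf C\subset\mathbb R^n$ be a code, i.e. a finite set of codewords of length $n$ (for instance $\mathbf C\subset\{+1,-1\}^n$). Let $\vec X$ be a random vector in $\mathbb R^n$ with $P(\vec X\in\mathbf C)>0$, and let $\vec Z$ be a random variable with values in an arbitrary measurable space (side information about $\vec X$). Let $\vec N$ be a standard Gaussian vector in $\mathbb R^n$, with independent $\mathcal N(0,1)$ entries, that is independent of $(\vec X,\vec Z)$. For $\gamma\ge 0$ let $\vec Y=\vec Y_\gamma=\sqrt{\gamma}\,\vec X+\vec N$ be the output of the Gaussian channel with signal to noise ratio $\gamma$. Put $Q=P(\,\cdot\mid\vec X\in\mathbf C)$ and $$\phi(\vec X\mid\vec X\in\mathbf C,\vec Y,\vec Z,\gamma)=\frac1n\,E_Q\Big[\big|\vec X-E_Q[\vec X\mid\vec Y_\gamma,\vec Z]\big|^2\Big],$$ the average minimum mean squared error, where $|\cdot|$ is the Euclidean norm, and let $H(\vec X\mid\vec X\in\mathbf C,\vec Z)$ be the conditional entropy in bits of $\vec X$ given $\vec Z$ under $Q$. Then $\gamma\mapsto\phi(\vec X\mid\vec X\in\mathbf C,\vec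 Y,\vec Z,\gamma)$ is integrable on $(0,\infty)$ and $$\int_0^\infty\phi(\vec X\mid\vec X\in\mathbf C,\vec Y,\vec Z,\gamma)\,d\gamma=\frac{\ln 4}{n}\,H(\vec X\mid\vec X\in\mathbf C,\vec Z).$$ -/

import Mathlib

open MeasureTheory ProbabilityTheory

noncomputable section

namespace AreaProperty

/-- Shannon entropy, in bits, of a discrete distribution `ν`: `-∑ ν{x} log₂ ν{x}`. -/
def entropyBits {E : Type*} [MeasurableSpace E] (ν : Measure E) : ℝ :=
  (∑' x : E, Real.negMulLog (ν.real {x})) / Real.log 2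

/-- Conditional entropy `H(X | Z)`, in bits, of a discrete random variable `X` given an arbitrary
random variable `Z`: the entropy of the conditional law of `X` given `Z = z`, averaged over the
law of `Z`. -/
def condEntropyBits {Ω E F : Type*} [MeasurableSpace Ω] [MeasurableSpace E] [StandardBorelSpace E]
    [Nonempty E] [MeasurableSpace F] (X : Ω → E) (Z : Ω → F) (μ : Measure Ω) [IsFiniteMeasure μ] :
    ℝ :=
  ∫ z, entropyBits (condDistrib X Z μ z) ∂(μ.map Z)

/-- Average minimum mean squared error in estimating the `n` entries of `X` from `W`:
`(1/n) E[|X - E[X | W]|²]`. -/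
def avgMMSE {Ω F : Type*} [MeasurableSpace Ω] [MeasurableSpace F] {n : ℕ}
    (X : Ω → EuclideanSpace ℝ (Fin n)) (W : Ω → F) (μ : Measure Ω) : ℝ :=
  (1 / (n : ℝ)) *
    ∫ ω, ‖X ω - (μ[X | MeasurableSpace.comap W inferInstance]) ω‖ ^ 2 ∂μ

/-- Output of the Gaussian channel with signal to noise ratio `γ`, input `X` and noise `N`. -/
def channelOutput {Ω : Type*} {n : ℕ} (γ : ℝ) (X N : Ω → EuclideanSpace ℝ (Fin n)) :
    Ω → EuclideanSpace ℝ (Fin n) :=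
  fun ω => Real.sqrt γ • X ω + N ω

end AreaProperty

end

/-!
Fix the transmitted codeword `c i` and the side information, and let `p` be the conditional prior
of the codewords. The *free energy* `g s = E_N log ∑ j, p j * exp (LLR j)`, where `LLR j` is the
log-likelihood ratio of `c j` against `c i` at the output of the channel with amplitude `s`, has
derivative `-s * E_N |E[X | Y] - c i|²` by Stein's identity. Since `γ = s²`, the squared error is
the `γ`-derivative of `-2 g(√γ)`. Now `g 0 = 0`, and `g s → log (p i)` as `s → ∞` because
the likelihood ratios of the wrong codewords vanish, so the squared error integrates to
`-2 log (p i)`. Averaging over the codeword gives twice the entropy of `p` in nats, that is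
`ln 4` times its entropy in bits, and averaging over the side information gives the theorem by
Fubini.
-/

namespace AreaProperty

open Filter Set
open scoped RealInnerProductSpace Topology

section Gaussian

variable {E : Type*} [NormedAddCommGroup E] [InnerProductSpace ℝ E]

/-- The log-likelihood ratio `⟪v, x⟫ - ‖v‖² / 2`, at the observation `x`, of the Gaussian measure
with mean `v` and identity covariance against the standard Gaussian measure. -/
noncomputable def gaussianLLR (v x : E) : ℝ := ⟪v, x⟫ - ‖v‖ ^ 2 / 2

lemma gaussianLLR_eq (v x : E) : gaussianLLR v x = (‖x‖ ^ 2 - ‖x - v‖ ^ 2) / 2 := by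
  rw [gaussianLLR, norm_sub_sq_real, real_inner_comm]
  ring

lemma gaussianLLR_le (v x : E) : gaussianLLR v x ≤ ‖x‖ ^ 2 / 2 := by
  rw [gaussianLLR_eq]
  linarith [sq_nonneg ‖x - v‖]

@[simp]
lemma gaussianLLR_zero_left (x : E) : gaussianLLR 0 x = 0 := by simp [gaussianLLR]

lemma gaussianLLR_add_right (u v x : E) :
    gaussianLLR v (u + x) = gaussianLLR (v - u) x + (‖u + x‖ ^ 2 - ‖x‖ ^ 2) / 2 := by
  rw [gaussianLLR_eq, gaussianLLR_eq, show u + x - v = x - (v - u) by abel]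
  ring

@[fun_prop]
lemma continuous_gaussianLLR : Continuous fun q : E × E => gaussianLLR q.1 q.2 := by
  unfold gaussianLLR
  fun_prop

variable (E) in
/-- The density of the standard Gaussian measure on the Euclidean space `E` with respect to the
Lebesgue measure. -/
noncomputable def gaussianDensity (x : E) : ℝ :=
  ((2 * Real.pi) ^ ((Module.finrank ℝ E : ℝ) / 2))⁻¹ * Real.exp (-‖x‖ ^ 2 / 2)

lemma gaussianDensity_pos (x : E) : 0 < gaussianDensity E x := by
  unfold gaussianDensity
  positivity

lemma continuous_gaussianDensity : Continuous (gaussianDensity E) := by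
  unfold gaussianDensity
  fun_prop

lemma gaussianDensity_sub (v x : E) :
    gaussianDensity E (x - v) = gaussianDensity E x * Real.exp (gaussianLLR v x) := by
  rw [gaussianDensity, gaussianDensity, gaussianLLR_eq, mul_assoc, ← Real.exp_add]
  ring_nf

lemma hasLineDerivAt_gaussianDensity (v x : E) :
    HasLineDerivAt ℝ (gaussianDensity E) (-(gaussianDensity E x * ⟪v, x⟫)) x v := by
  have hline : HasDerivAt (fun t : ℝ => x + t • v) v 0 := by
    simpa using ((hasDerivAt_id (0 : ℝ)).smul_const v).const_add x
  refine ((hline.norm_sq.neg.div_const 2).exp.const_mul _).congr_deriv ?_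
  simp only [gaussianDensity, Pi.neg_apply, zero_smul, add_zero, real_inner_comm]
  ring

variable [FiniteDimensional ℝ E] [MeasurableSpace E] [BorelSpace E]

lemma integrable_gaussianDensity : Integrable (gaussianDensity E) := by
  have h := GaussianFourier.integrable_cexp_neg_mul_sq_norm_add (V := E) (b := 1 / 2)
    (by norm_num) 0 0
  refine (h.norm.congr (ae_of_all _ fun x => ?_)).const_mul _
  simp only [Complex.norm_exp]
  congr 1
  simp [← Complex.ofReal_pow]
  ring

lemma integral_gaussianDensity_smul_cexp (t : E) :
    ∫ x, gaussianDensity E x • Complex.exp (⟪x, t⟫ * Complex.I) =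
      Complex.exp (-(‖t‖ ^ 2 / 2)) := by
  have h := GaussianFourier.integral_cexp_neg_mul_sq_norm_add (V := E) (b := 1 / 2)
    (by norm_num) Complex.I t
  set κ : ℂ := (2 * Real.pi) ^ ((Module.finrank ℝ E : ℂ) / 2) with hκ
  have hκ0 : κ ≠ 0 := by simp [hκ, Complex.cpow_eq_zero_iff, Real.pi_ne_zero]
  have hintegrand (x : E) : gaussianDensity E x • Complex.exp (⟪x, t⟫ * Complex.I) =
      κ⁻¹ * Complex.exp (-(1 / 2) * ‖x‖ ^ 2 + Complex.I * ⟪t, x⟫) := by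
    rw [gaussianDensity, Complex.real_smul, Complex.ofReal_mul, mul_assoc, Complex.ofReal_exp,
      ← Complex.exp_add, Complex.ofReal_inv, Complex.ofReal_cpow (by positivity), real_inner_comm]
    push_cast
    congr 2
    ring
  simp_rw [hintegrand]
  rw [integral_const_mul, h, show (Real.pi : ℂ) / (1 / 2) = 2 * Real.pi by ring,
    inv_mul_cancel_left₀ hκ0, Complex.I_sq]
  congr 1
  ring

lemma stdGaussian_eq_withDensity :
    stdGaussian E = volume.withDensity fun x => ENNReal.ofReal (gaussianDensity E x) := by
  have : IsFiniteMeasure ((volume : Measure E).withDensity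
      fun x => ENNReal.ofReal (gaussianDensity E x)) :=
    isFiniteMeasure_withDensity_ofReal integrable_gaussianDensity.2
  refine Measure.ext_of_charFun (funext fun t => ?_)
  rw [charFun_stdGaussian, charFun_apply, integral_withDensity_eq_integral_toReal_smul
      continuous_gaussianDensity.measurable.ennreal_ofReal (by simp)]
  simp_rw [ENNReal.toReal_ofReal (gaussianDensity_pos _).le]
  rw [integral_gaussianDensity_smul_cexp, neg_div]

variable {F : Type*} [NormedAddCommGroup F] [NormedSpace ℝ F]

lemma integral_stdGaussian (f : E → F) :
    ∫ x, f x ∂(stdGaussian E) = ∫ x, gaussianDensity E x • f x := by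
  rw [stdGaussian_eq_withDensity, integral_withDensity_eq_integral_toReal_smul
      continuous_gaussianDensity.measurable.ennreal_ofReal (by simp)]
  simp_rw [ENNReal.toReal_ofReal (gaussianDensity_pos _).le]

lemma integrable_stdGaussian_iff {f : E → F} :
    Integrable f (stdGaussian E) ↔ Integrable fun x => gaussianDensity E x • f x := by
  rw [stdGaussian_eq_withDensity, integrable_withDensity_iff_integrable_smul'
      continuous_gaussianDensity.measurable.ennreal_ofReal (by simp)]
  simp_rw [ENNReal.toReal_ofReal (gaussianDensity_pos _).le]

lemma integral_comp_add_left_stdGaussian (f : E → F) (v : E) :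
    ∫ x, f (v + x) ∂(stdGaussian E) =
      ∫ x, Real.exp (gaussianLLR v x) • f x ∂(stdGaussian E) := by
  rw [integral_stdGaussian, integral_stdGaussian,
    ← integral_sub_right_eq_self (fun x => gaussianDensity E x • f (v + x)) v]
  simp [gaussianDensity_sub, smul_smul]

lemma integrable_exp_gaussianLLR_smul {f : E → F} {v : E}
    (hf : Integrable (fun x => f (v + x)) (stdGaussian E)) :
    Integrable (fun x => Real.exp (gaussianLLR v x) • f x) (stdGaussian E) := by
  rw [integrable_stdGaussian_iff] at hf ⊢
  simpa [gaussianDensity_sub, smul_smul] using hf.comp_sub_right v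

/-- Stein's identity. -/
lemma integral_inner_smul_stdGaussian {g g' : E → F} {v : E}
    (hg : ∀ x, HasLineDerivAt ℝ g (g' x) x v)
    (hgi : Integrable g (stdGaussian E)) (hgi' : Integrable g' (stdGaussian E))
    (hgv : Integrable (fun x => ⟪v, x⟫ • g x) (stdGaussian E)) :
    ∫ x, ⟪v, x⟫ • g x ∂(stdGaussian E) = ∫ x, g' x ∂(stdGaussian E) := by
  rw [integral_stdGaussian, integral_stdGaussian]
  rw [integrable_stdGaussian_iff] at hgi hgi' hgv
  have hparts := integral_bilinear_hasLineDerivAt_right_eq_neg_left_of_integrable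
    (B := ContinuousLinearMap.lsmul ℝ ℝ)
    (by simpa only [ContinuousLinearMap.lsmul_apply, neg_smul, mul_smul] using hgv.fun_neg)
    hgi' hgi (fun x _ => hasLineDerivAt_gaussianDensity v x) (fun x _ => hg x)
  simpa only [ContinuousLinearMap.lsmul_apply, neg_smul, mul_smul, integral_neg, neg_neg]
    using hparts.symm

lemma integrable_norm_stdGaussian : Integrable (fun x : E => ‖x‖) (stdGaussian E) :=
  IsGaussian.integrable_id.norm

lemma integrable_norm_sq_stdGaussian : Integrable (fun x : E => ‖x‖ ^ 2) (stdGaussian E) :=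
  IsGaussian.memLp_two_id.integrable_norm_pow (by norm_num)

end Gaussian

section Gibbs

variable {ι : Type*} [Fintype ι] {V : Type*} [NormedAddCommGroup V] [NormedSpace ℝ V]

/-- The partition function `∑ p j * exp (a j)` of the weights `p` and log-likelihoods `a`. -/
noncomputable def partitionFn (p a : ι → ℝ) : ℝ := ∑ j, p j * Real.exp (a j)

/-- The Gibbs distribution: the weights `p` tilted by `exp a` and normalized. It is the posterior
distribution of the prior `p` under the log-likelihoods `a`. -/
noncomputable def gibbsWeight (p a : ι → ℝ) (j : ι) : ℝ := p j * Real.exp (a j) / partitionFn p a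

/-- The mean of `b` under the Gibbs distribution. -/
noncomputable def gibbsMean (p a : ι → ℝ) (b : ι → V) : V := ∑ j, gibbsWeight p a j • b j

variable {p : ι → ℝ}

lemma pos_of_mem_stdSimplex (hp : p ∈ stdSimplex ℝ ι) : 0 < p := by
  obtain ⟨j, -, hj⟩ := Finset.exists_ne_zero_of_sum_ne_zero (hp.2.trans_ne one_ne_zero)
  exact Pi.lt_def.2 ⟨hp.1, j, (hp.1 j).lt_of_ne' hj⟩

lemma le_partitionFn (hp : 0 ≤ p) (a : ι → ℝ) (j : ι) : p j * Real.exp (a j) ≤ partitionFn p a :=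
  Finset.single_le_sum (f := fun j => p j * Real.exp (a j))
    (fun j _ => mul_nonneg (hp j) (Real.exp_pos _).le) (Finset.mem_univ j)

lemma partitionFn_nonneg (hp : 0 ≤ p) (a : ι → ℝ) : 0 ≤ partitionFn p a :=
  Finset.sum_nonneg fun j _ => mul_nonneg (hp j) (Real.exp_pos _).le

lemma partitionFn_pos (hp : 0 < p) (a : ι → ℝ) : 0 < partitionFn p a := by
  obtain ⟨hp0, i, hi⟩ := Pi.lt_def.1 hp
  exact (mul_pos hi (Real.exp_pos _)).trans_le (le_partitionFn hp0 a i)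

lemma gibbsWeight_nonneg (hp : 0 ≤ p) (a : ι → ℝ) (j : ι) : 0 ≤ gibbsWeight p a j :=
  div_nonneg (mul_nonneg (hp j) (Real.exp_pos _).le) (partitionFn_nonneg hp a)

lemma gibbsWeight_le_one (hp : 0 ≤ p) (a : ι → ℝ) (j : ι) : gibbsWeight p a j ≤ 1 :=
  div_le_one_of_le₀ (le_partitionFn hp a j) (partitionFn_nonneg hp a)

lemma sum_gibbsWeight (hp : 0 < p) (a : ι → ℝ) : ∑ j, gibbsWeight p a j = 1 := by
  simp only [gibbsWeight, ← Finset.sum_div]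
  exact div_self (partitionFn_pos hp a).ne'

lemma gibbsWeight_add_const (p a : ι → ℝ) (t : ℝ) :
    gibbsWeight p (fun j => a j + t) = gibbsWeight p a := by
  ext j
  simp only [gibbsWeight, partitionFn, Real.exp_add, ← mul_assoc, ← Finset.sum_mul]
  exact mul_div_mul_right _ _ (Real.exp_pos t).ne'

lemma gibbsMean_add_const (p a : ι → ℝ) (t : ℝ) (b : ι → V) :
    gibbsMean p (fun j => a j + t) b = gibbsMean p a b := by
  rw [gibbsMean, gibbsWeight_add_const, gibbsMean]

lemma norm_gibbsMean_le (hp : 0 ≤ p) (a : ι → ℝ) (b : ι → V) :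
    ‖gibbsMean p a b‖ ≤ ∑ j, ‖b j‖ := by
  refine (norm_sum_le _ _).trans (Finset.sum_le_sum fun j _ => ?_)
  rw [norm_smul, Real.norm_of_nonneg (gibbsWeight_nonneg hp a j)]
  exact mul_le_of_le_one_left (norm_nonneg _) (gibbsWeight_le_one hp a j)

lemma gibbsMean_sub_const (hp : 0 < p) (a : ι → ℝ) (b : ι → V) (v : V) :
    gibbsMean p a (fun j => b j - v) = gibbsMean p a b - v := by
  simp only [gibbsMean, smul_sub, Finset.sum_sub_distrib, ← Finset.sum_smul, sum_gibbsWeight hp,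
    one_smul]

lemma map_gibbsMean {W : Type*} [NormedAddCommGroup W] [NormedSpace ℝ W] (L : V →L[ℝ] W)
    (p a : ι → ℝ) (b : ι → V) : L (gibbsMean p a b) = gibbsMean p a (fun j => L (b j)) := by
  simp only [gibbsMean, map_sum, map_smul]

lemma gibbsMean_eq_inv_smul (p a : ι → ℝ) (b : ι → V) :
    gibbsMean p a b = (partitionFn p a)⁻¹ • ∑ j, (p j * Real.exp (a j)) • b j := by
  simp only [gibbsMean, gibbsWeight, div_eq_inv_mul, mul_smul, Finset.smul_sum]

lemma sum_smul_sub_gibbsMean (hp : 0 ≤ p) (a : ι → ℝ) (b : ι → V) :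
    ∑ j, (p j * Real.exp (a j)) • (b j - gibbsMean p a b) = 0 := by
  rcases hp.eq_or_lt with rfl | hp
  · simp
  · rw [gibbsMean_eq_inv_smul]
    simp only [smul_sub, Finset.sum_sub_distrib, ← Finset.sum_smul]
    rw [← partitionFn, smul_inv_smul₀ (partitionFn_pos hp a).ne', sub_self]

section Deriv

variable {a : ℝ → ι → ℝ} {a' : ι → ℝ} {t : ℝ}

lemma hasDerivAt_log_partitionFn (hp : 0 < p) (ha : ∀ j, HasDerivAt (fun u => a u j) (a' j) t) :
    HasDerivAt (fun u => Real.log (partitionFn p (a u))) (gibbsMean p (a t) a') t := by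
  have hZ : HasDerivAt (fun u => partitionFn p (a u)) (∑ j, p j * (Real.exp (a t j) * a' j)) t :=
    HasDerivAt.fun_sum fun j _ => (ha j).exp.const_mul (p j)
  refine (hZ.log (partitionFn_pos hp _).ne').congr_deriv ?_
  simp only [gibbsMean_eq_inv_smul, smul_eq_mul, mul_assoc, div_eq_inv_mul]

-- The Gibbs weight is `p j * exp (a j - log (partitionFn p a))`, which reduces its derivative to
-- that of the log-partition function.
lemma hasDerivAt_gibbsWeight (hp : 0 < p) (ha : ∀ j, HasDerivAt (fun u => a u j) (a' j) t)
    (j : ι) :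
    HasDerivAt (fun u => gibbsWeight p (a u) j)
      (gibbsWeight p (a t) j * (a' j - gibbsMean p (a t) a')) t := by
  have hexp (u : ℝ) :
      gibbsWeight p (a u) j = p j * Real.exp (a u j - Real.log (partitionFn p (a u))) := by
    rw [gibbsWeight, Real.exp_sub, Real.exp_log (partitionFn_pos hp _), mul_div_assoc]
  have h := ((ha j).fun_sub (hasDerivAt_log_partitionFn hp ha)).exp.const_mul (p j)
  simp only [hexp]
  simpa only [mul_assoc] using h

end Deriv

lemma continuous_partitionFn (p : ι → ℝ) : Continuous (partitionFn p) := by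
  unfold partitionFn
  fun_prop

lemma continuous_gibbsWeight (hp : 0 < p) (j : ι) : Continuous fun a => gibbsWeight p a j :=
  .div (by fun_prop) (continuous_partitionFn p) fun a => (partitionFn_pos hp a).ne'

lemma continuous_gibbsMean (hp : 0 < p) (b : ι → V) : Continuous fun a => gibbsMean p a b :=
  continuous_finsetSum _ fun j _ => (continuous_gibbsWeight hp j).smul continuous_const

lemma measurable_gibbsMean [MeasurableSpace V] [BorelSpace V] [SecondCountableTopology V]
    (b : ι → V) : Measurable fun q : (ι → ℝ) × (ι → ℝ) => gibbsMean q.1 q.2 b := by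
  unfold gibbsMean gibbsWeight partitionFn
  fun_prop

end Gibbs

section Channel

variable {E : Type*} [NormedAddCommGroup E] [InnerProductSpace ℝ E] {ι : Type*}

/-- The log-likelihoods of the codewords at amplitude `s = √γ` and noise `x`, relative to the
transmitted codeword; `d j` is the displacement of the `j`-th codeword from the transmitted one. -/
noncomputable def channelLLR (d : ι → E) (s : ℝ) (x : E) (j : ι) : ℝ := gaussianLLR (s • d j) x

lemma channelLLR_eq (d : ι → E) (s : ℝ) (x : E) (j : ι) :
    channelLLR d s x j = s * ⟪d j, x⟫ - s ^ 2 * ‖d j‖ ^ 2 / 2 := by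
  rw [channelLLR, gaussianLLR, real_inner_smul_left, norm_smul, mul_pow, Real.norm_eq_abs, sq_abs]

lemma channelLLR_smul_add (c : ι → E) (s : ℝ) (x : E) (i j : ι) :
    channelLLR c s (s • c i + x) j =
      channelLLR (fun k => c k - c i) s x j + (‖s • c i + x‖ ^ 2 - ‖x‖ ^ 2) / 2 := by
  rw [channelLLR, gaussianLLR_add_right, channelLLR, smul_sub]

lemma hasDerivAt_channelLLR (d : ι → E) (s : ℝ) (x : E) (j : ι) :
    HasDerivAt (fun u => channelLLR d u x j) (⟪d j, x⟫ - s * ‖d j‖ ^ 2) s := by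
  simp only [channelLLR_eq]
  refine (((hasDerivAt_id s).mul_const ⟪d j, x⟫).sub
    (((hasDerivAt_pow 2 s).mul_const (‖d j‖ ^ 2)).div_const 2)).congr_deriv ?_
  ring

lemma hasDerivAt_channelLLR_add_smul (d : ι → E) (s : ℝ) (x v : E) (j : ι) :
    HasDerivAt (fun t : ℝ => channelLLR d s (x + t • v) j) (s * ⟪d j, v⟫) 0 := by
  simp only [channelLLR_eq, inner_add_right, real_inner_smul_right]
  refine (((((hasDerivAt_id (0 : ℝ)).mul_const ⟪d j, v⟫).const_add
    ⟪d j, x⟫).const_mul s).sub_const _).congr_deriv ?_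
  ring

@[fun_prop]
lemma continuous_channelLLR (d : ι → E) : Continuous fun q : ℝ × E => channelLLR d q.1 q.2 := by
  unfold channelLLR
  fun_prop

lemma tendsto_channelLLR_atBot {d : ι → E} {j : ι} (hj : d j ≠ 0) (x : E) :
    Tendsto (fun s => channelLLR d s x j) atTop atBot := by
  have hfactor (s : ℝ) : channelLLR d s x j = s * (⟪d j, x⟫ + s * (-(‖d j‖ ^ 2 / 2))) := by
    rw [channelLLR_eq]
    ring
  simp only [hfactor]
  refine tendsto_id.atTop_mul_atBot₀ (tendsto_atBot_add_const_left _ _ ?_)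
  exact tendsto_id.atTop_mul_const_of_neg (by simpa [sq_pos_iff] using hj)

variable [Fintype ι] {p : ι → ℝ} {d : ι → E} {i : ι}

/-- The posterior mean of the displacement from the transmitted codeword, at prior `p`, amplitude
`s` and noise `x`. -/
noncomputable def meanDisplacement (p : ι → ℝ) (d : ι → E) (s : ℝ) (x : E) : E :=
  gibbsMean p (channelLLR d s x) d

lemma continuous_log_partitionFn_channelLLR (hp : 0 < p) (d : ι → E) (s : ℝ) :
    Continuous fun x => Real.log (partitionFn p (channelLLR d s x)) :=
  ((continuous_partitionFn p).comp (by fun_prop)).log fun _ => (partitionFn_pos hp _).ne'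

lemma continuous_gibbsWeight_channelLLR (hp : 0 < p) (d : ι → E) (s : ℝ) (j : ι) :
    Continuous fun x => gibbsWeight p (channelLLR d s x) j :=
  (continuous_gibbsWeight hp j).comp (by fun_prop)

lemma continuous_meanDisplacement (hp : 0 < p) (d : ι → E) (s : ℝ) :
    Continuous (meanDisplacement p d s) :=
  (continuous_gibbsMean hp d).comp (by fun_prop)

lemma norm_meanDisplacement_le (hp : 0 ≤ p) (d : ι → E) (s : ℝ) (x : E) :
    ‖meanDisplacement p d s x‖ ≤ ∑ j, ‖d j‖ :=
  norm_gibbsMean_le hp _ d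

lemma abs_log_partitionFn_le (hp : p ∈ stdSimplex ℝ ι) (hi : 0 < p i) (hd : d i = 0) (s : ℝ)
    (x : E) :
    |Real.log (partitionFn p (channelLLR d s x))| ≤ ‖x‖ ^ 2 / 2 + |Real.log (p i)| := by
  have hlower : Real.log (p i) ≤ Real.log (partitionFn p (channelLLR d s x)) := by
    refine Real.log_le_log hi ?_
    simpa [channelLLR, hd] using le_partitionFn hp.1 (channelLLR d s x) i
  have hupper : Real.log (partitionFn p (channelLLR d s x)) ≤ ‖x‖ ^ 2 / 2 := by
    rw [Real.log_le_iff_le_exp (partitionFn_pos (pos_of_mem_stdSimplex hp) _)]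
    calc partitionFn p (channelLLR d s x) ≤ ∑ j, p j * Real.exp (‖x‖ ^ 2 / 2) := by
          unfold partitionFn
          gcongr with j
          exacts [hp.1 j, gaussianLLR_le _ x]
      _ = Real.exp (‖x‖ ^ 2 / 2) := by rw [← Finset.sum_mul, hp.2, one_mul]
  rw [abs_le]
  constructor <;> linarith [neg_abs_le (Real.log (p i)), abs_nonneg (Real.log (p i)), sq_nonneg ‖x‖]

lemma tendsto_partitionFn_channelLLR (p : ι → ℝ) (hd : ∀ j, d j = 0 ↔ j = i) (x : E) :
    Tendsto (fun s => partitionFn p (channelLLR d s x)) atTop (𝓝 (p i)) := by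
  classical
  have hp : p i = ∑ j, p j * (if j = i then 1 else 0) := by simp
  unfold partitionFn
  rw [hp]
  refine tendsto_finsetSum _ fun j _ => .const_mul _ ?_
  split_ifs with hj
  · simp [channelLLR, (hd j).2 hj]
  · exact Real.tendsto_exp_atBot.comp (tendsto_channelLLR_atBot (mt (hd j).1 hj) x)

lemma hasLineDerivAt_gibbsWeight_channelLLR (hp : 0 < p) (d : ι → E) (s : ℝ) (v : E) (j : ι)
    (x : E) :
    HasLineDerivAt ℝ (fun x => gibbsWeight p (channelLLR d s x) j)
      (s * (gibbsWeight p (channelLLR d s x) j * ⟪v, d j - meanDisplacement p d s x⟫)) x v := by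
  have hmean : gibbsMean p (channelLLR d s x) (fun k => s * ⟪d k, v⟫) =
      s * ⟪v, meanDisplacement p d s x⟫ := by
    simpa [meanDisplacement, real_inner_comm] using
      (map_gibbsMean (s • innerSL ℝ v) p (channelLLR d s x) d).symm
  refine (hasDerivAt_gibbsWeight hp
    (fun k => hasDerivAt_channelLLR_add_smul d s x v k) j).congr_deriv ?_
  simp only [zero_smul, add_zero]
  rw [hmean, inner_sub_right, real_inner_comm]
  ring

lemma abs_gibbsMean_deriv_channelLLR_le (hp : 0 ≤ p) (d : ι → E) {s u : ℝ} (hu : |u| ≤ s)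
    (x : E) :
    |gibbsMean p (channelLLR d u x) (fun j => ⟪d j, x⟫ - u * ‖d j‖ ^ 2)| ≤
      ∑ j, (‖d j‖ * ‖x‖ + s * ‖d j‖ ^ 2) := by
  refine (norm_gibbsMean_le (V := ℝ) hp _ _).trans (Finset.sum_le_sum fun j _ => ?_)
  refine (norm_sub_le _ _).trans (add_le_add (norm_inner_le_norm _ _) ?_)
  rw [norm_mul, Real.norm_eq_abs, norm_pow, norm_norm]
  gcongr

variable [FiniteDimensional ℝ E] [MeasurableSpace E]

/-- The expected log-partition function of the channel, as a function of the amplitude. -/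
noncomputable def freeEnergy (p : ι → ℝ) (d : ι → E) (s : ℝ) : ℝ :=
  ∫ x, Real.log (partitionFn p (channelLLR d s x)) ∂(stdGaussian E)

/-- The mean squared error of the posterior mean, given the transmitted codeword. -/
noncomputable def codewordError (p : ι → ℝ) (d : ι → E) (s : ℝ) : ℝ :=
  ∫ x, ‖meanDisplacement p d s x‖ ^ 2 ∂(stdGaussian E)

lemma codewordError_nonneg (p : ι → ℝ) (d : ι → E) (s : ℝ) : 0 ≤ codewordError p d s :=
  integral_nonneg fun _ => sq_nonneg _

lemma freeEnergy_zero (hp : p ∈ stdSimplex ℝ ι) (d : ι → E) : freeEnergy p d 0 = 0 := by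
  simp [freeEnergy, partitionFn, channelLLR, hp.2]

variable [BorelSpace E]

lemma integrable_log_partitionFn_channelLLR (hp : p ∈ stdSimplex ℝ ι) (hi : 0 < p i)
    (hd : d i = 0) (s : ℝ) :
    Integrable (fun x => Real.log (partitionFn p (channelLLR d s x))) (stdGaussian E) :=
  ((integrable_norm_sq_stdGaussian.div_const 2).add (integrable_const |Real.log (p i)|)).mono'
    (continuous_log_partitionFn_channelLLR (pos_of_mem_stdSimplex hp) d s).aestronglyMeasurable
    (ae_of_all _ fun x => abs_log_partitionFn_le hp hi hd s x)

lemma integrable_gibbsWeight_channelLLR (hp : 0 < p) (d : ι → E) (s : ℝ) (j : ι) :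
    Integrable (fun x => gibbsWeight p (channelLLR d s x) j) (stdGaussian E) :=
  .of_bound (continuous_gibbsWeight_channelLLR hp d s j).aestronglyMeasurable 1
    (ae_of_all _ fun x => by
      rw [Real.norm_of_nonneg (gibbsWeight_nonneg hp.le _ j)]
      exact gibbsWeight_le_one hp.le _ j)

lemma integrable_inner_mul_gibbsWeight (hp : 0 < p) (d : ι → E) (s : ℝ) (v : E) (j : ι) :
    Integrable (fun x => ⟪v, x⟫ * gibbsWeight p (channelLLR d s x) j) (stdGaussian E) := by
  have hcont := continuous_gibbsWeight_channelLLR hp d s j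
  refine (integrable_norm_stdGaussian.const_mul ‖v‖).mono'
    (Continuous.aestronglyMeasurable (by fun_prop)) (ae_of_all _ fun x => ?_)
  rw [norm_mul, Real.norm_of_nonneg (gibbsWeight_nonneg hp.le _ j)]
  exact (mul_le_of_le_one_right (norm_nonneg _) (gibbsWeight_le_one hp.le _ j)).trans
    (norm_inner_le_norm v x)

lemma integrable_gibbsWeight_mul_inner (hp : 0 < p) (d : ι → E) (s : ℝ) (v : E) (j : ι) :
    Integrable (fun x => gibbsWeight p (channelLLR d s x) j * ⟪v, d j - meanDisplacement p d s x⟫)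
      (stdGaussian E) := by
  have hcont := continuous_meanDisplacement hp d s
  refine (integrable_gibbsWeight_channelLLR hp d s j).mul_bdd
    (c := ‖v‖ * (‖d j‖ + ∑ k, ‖d k‖)) (Continuous.aestronglyMeasurable (by fun_prop))
    (ae_of_all _ fun x => (norm_inner_le_norm v _).trans ?_)
  gcongr
  exact (norm_sub_le _ _).trans (by gcongr; exact norm_meanDisplacement_le hp.le d s x)

lemma integral_inner_mul_gibbsWeight (hp : 0 < p) (d : ι → E) (s : ℝ) (v : E) (j : ι) :
    ∫ x, ⟪v, x⟫ * gibbsWeight p (channelLLR d s x) j ∂(stdGaussian E) =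
      ∫ x, s * (gibbsWeight p (channelLLR d s x) j * ⟪v, d j - meanDisplacement p d s x⟫)
        ∂(stdGaussian E) :=
  integral_inner_smul_stdGaussian (hasLineDerivAt_gibbsWeight_channelLLR hp d s v j)
    (integrable_gibbsWeight_channelLLR hp d s j)
    ((integrable_gibbsWeight_mul_inner hp d s v j).const_mul s)
    (integrable_inner_mul_gibbsWeight hp d s v j)

-- Stein's identity, applied to each Gibbs weight in the direction of its own displacement, turns
-- the term linear in the noise into a posterior variance, whose `‖d j‖ ^ 2` part cancels.
lemma integral_gibbsMean_deriv_channelLLR (hp : 0 < p) (d : ι → E) (s : ℝ) :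
    ∫ x, gibbsMean p (channelLLR d s x) (fun j => ⟪d j, x⟫ - s * ‖d j‖ ^ 2) ∂(stdGaussian E) =
      -(s * codewordError p d s) := by
  set w : E → ι → ℝ := fun x => gibbsWeight p (channelLLR d s x)
  set M : E → E := meanDisplacement p d s
  have hM (x : E) : ∑ j, w x j • d j = M x := rfl
  have hw (j : ι) := (integrable_gibbsWeight_channelLLR hp d s j).const_mul (s * ‖d j‖ ^ 2)
  have hinner (j : ι) := integrable_inner_mul_gibbsWeight hp d s (d j) j
  have hstein (j : ι) := (integrable_gibbsWeight_mul_inner hp d s (d j) j).const_mul s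
  calc ∫ x, gibbsMean p (channelLLR d s x) (fun j => ⟪d j, x⟫ - s * ‖d j‖ ^ 2) ∂(stdGaussian E)
      = ∫ x, ∑ j, (⟪d j, x⟫ * w x j - s * ‖d j‖ ^ 2 * w x j) ∂(stdGaussian E) := by
        simp only [gibbsMean, smul_eq_mul, mul_sub, w, mul_comm]
    _ = ∑ j, (∫ x, ⟪d j, x⟫ * w x j ∂(stdGaussian E) -
          ∫ x, s * ‖d j‖ ^ 2 * w x j ∂(stdGaussian E)) := by
        rw [integral_finsetSum _ fun j _ => (hinner j).sub' (hw j)]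
        exact Finset.sum_congr rfl fun j _ => integral_sub (hinner j) (hw j)
    _ = ∑ j, ∫ x, (s * (w x j * ⟪d j, d j - M x⟫) - s * ‖d j‖ ^ 2 * w x j) ∂(stdGaussian E) := by
        refine Finset.sum_congr rfl fun j _ => ?_
        rw [integral_sub (hstein j) (hw j), ← integral_inner_mul_gibbsWeight hp]
    _ = ∫ x, ∑ j, -(s * ⟪w x j • d j, M x⟫) ∂(stdGaussian E) := by
        rw [← integral_finsetSum _ fun j _ => (hstein j).sub' (hw j)]
        refine integral_congr_ae (ae_of_all _ fun x => Finset.sum_congr rfl fun j _ => ?_)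
        simp only [inner_sub_right, real_inner_self_eq_norm_sq, real_inner_smul_left]
        ring
    _ = -(s * codewordError p d s) := by
        simp only [Finset.sum_neg_distrib, ← Finset.mul_sum, ← sum_inner, hM, integral_neg,
          integral_const_mul, codewordError, ← real_inner_self_eq_norm_sq, M]

lemma hasDerivAt_freeEnergy (hp : p ∈ stdSimplex ℝ ι) (hi : 0 < p i) (hd : d i = 0) (s : ℝ) :
    HasDerivAt (freeEnergy p d) (-(s * codewordError p d s)) s := by
  have hp0 := pos_of_mem_stdSimplex hp
  have hcont (j : ι) := continuous_gibbsWeight_channelLLR hp0 d s j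
  rw [← integral_gibbsMean_deriv_channelLLR hp0]
  refine (hasDerivAt_integral_of_dominated_loc_of_deriv_le
    (F' := fun u x => gibbsMean p (channelLLR d u x) (fun j => ⟪d j, x⟫ - u * ‖d j‖ ^ 2))
    (bound := fun x => ∑ j, (‖d j‖ * ‖x‖ + (|s| + 1) * ‖d j‖ ^ 2))
    (Metric.ball_mem_nhds s one_pos)
    (.of_forall fun u => (continuous_log_partitionFn_channelLLR hp0 d u).aestronglyMeasurable)
    (integrable_log_partitionFn_channelLLR hp hi hd s)
    (Continuous.aestronglyMeasurable (by unfold gibbsMean; fun_prop))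
    (ae_of_all _ fun x u hu => abs_gibbsMean_deriv_channelLLR_le hp.1 d ?_ x)
    (integrable_finsetSum _ fun j _ =>
      (integrable_norm_stdGaussian.const_mul _).add (integrable_const _))
    (ae_of_all _ fun x u _ =>
      hasDerivAt_log_partitionFn hp0 fun j => hasDerivAt_channelLLR d u x j)).2
  rw [Metric.mem_ball, Real.dist_eq] at hu
  linarith [abs_sub_abs_le_abs_sub u s]

lemma tendsto_freeEnergy (hp : p ∈ stdSimplex ℝ ι) (hi : 0 < p i) (hd : ∀ j, d j = 0 ↔ j = i) :
    Tendsto (freeEnergy p d) atTop (𝓝 (Real.log (p i))) := by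
  have hlog : Real.log (p i) = ∫ _, Real.log (p i) ∂(stdGaussian E) := by simp
  rw [hlog]
  refine tendsto_integral_filter_of_dominated_convergence
    (fun x => ‖x‖ ^ 2 / 2 + |Real.log (p i)|)
    (.of_forall fun s => (continuous_log_partitionFn_channelLLR
      (pos_of_mem_stdSimplex hp) d s).aestronglyMeasurable)
    (.of_forall fun s => ae_of_all _ fun x =>
      abs_log_partitionFn_le hp hi ((hd i).2 rfl) s x)
    ((integrable_norm_sq_stdGaussian.div_const 2).add (integrable_const _))
    (ae_of_all _ fun x => (tendsto_partitionFn_channelLLR p hd x).log hi.ne')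

lemma continuous_freeEnergy (hp : p ∈ stdSimplex ℝ ι) (hi : 0 < p i) (hd : d i = 0) :
    Continuous (freeEnergy p d) :=
  continuous_iff_continuousAt.2 fun s => (hasDerivAt_freeEnergy hp hi hd s).continuousAt

lemma hasDerivAt_neg_two_mul_freeEnergy_sqrt (hp : p ∈ stdSimplex ℝ ι) (hi : 0 < p i)
    (hd : d i = 0) {γ : ℝ} (hγ : 0 < γ) :
    HasDerivAt (fun γ => -2 * freeEnergy p d √γ) (codewordError p d √γ) γ := by
  have : 0 < √γ := Real.sqrt_pos.2 hγ
  refine (((hasDerivAt_freeEnergy hp hi hd √γ).comp γ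
    (Real.hasDerivAt_sqrt hγ.ne')).const_mul (-2)).congr_deriv ?_
  field_simp

lemma tendsto_neg_two_mul_freeEnergy_sqrt (hp : p ∈ stdSimplex ℝ ι) (hi : 0 < p i)
    (hd : ∀ j, d j = 0 ↔ j = i) :
    Tendsto (fun γ => -2 * freeEnergy p d √γ) atTop (𝓝 (-2 * Real.log (p i))) :=
  ((tendsto_freeEnergy hp hi hd).comp Real.tendsto_sqrt_atTop).const_mul (-2)

lemma continuous_neg_two_mul_freeEnergy_sqrt (hp : p ∈ stdSimplex ℝ ι) (hi : 0 < p i)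
    (hd : d i = 0) : Continuous fun γ => -2 * freeEnergy p d √γ :=
  ((continuous_freeEnergy hp hi hd).comp Real.continuous_sqrt).const_mul (-2)

lemma integrableOn_codewordError_sqrt (hp : p ∈ stdSimplex ℝ ι) (hi : 0 < p i)
    (hd : ∀ j, d j = 0 ↔ j = i) :
    IntegrableOn (fun γ => codewordError p d √γ) (Ioi 0) :=
  integrableOn_Ioi_deriv_of_nonneg
    (continuous_neg_two_mul_freeEnergy_sqrt hp hi ((hd i).2 rfl)).continuousWithinAt
    (fun _ => hasDerivAt_neg_two_mul_freeEnergy_sqrt hp hi ((hd i).2 rfl))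
    (fun _ _ => codewordError_nonneg p d _) (tendsto_neg_two_mul_freeEnergy_sqrt hp hi hd)

lemma integral_codewordError_sqrt (hp : p ∈ stdSimplex ℝ ι) (hi : 0 < p i)
    (hd : ∀ j, d j = 0 ↔ j = i) :
    ∫ γ in Ioi 0, codewordError p d √γ = -2 * Real.log (p i) := by
  rw [integral_Ioi_of_hasDerivAt_of_nonneg
    (continuous_neg_two_mul_freeEnergy_sqrt hp hi ((hd i).2 rfl)).continuousWithinAt
    (fun _ => hasDerivAt_neg_two_mul_freeEnergy_sqrt hp hi ((hd i).2 rfl))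
    (fun _ _ => codewordError_nonneg p d _) (tendsto_neg_two_mul_freeEnergy_sqrt hp hi hd),
    Real.sqrt_zero, freeEnergy_zero hp, mul_zero, sub_zero]

end Channel

section Posterior

variable {E : Type*} [NormedAddCommGroup E] [InnerProductSpace ℝ E] {ι : Type*} [Fintype ι]
  {p : ι → ℝ} {c : ι → E}

/-- The posterior mean of the codeword, given the channel output `y` at amplitude `s`, for the
codebook `c` with prior `p`. -/
noncomputable def posteriorMean (p : ι → ℝ) (c : ι → E) (s : ℝ) (y : E) : E :=
  gibbsMean p (channelLLR c s y) c

lemma norm_posteriorMean_le (hp : 0 ≤ p) (c : ι → E) (s : ℝ) (y : E) :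
    ‖posteriorMean p c s y‖ ≤ ∑ j, ‖c j‖ :=
  norm_gibbsMean_le hp _ c

lemma norm_sub_posteriorMean_le (hp : 0 ≤ p) (c : ι → E) (s : ℝ) (y : E) (i : ι) :
    ‖c i - posteriorMean p c s y‖ ≤ ‖c i‖ + ∑ j, ‖c j‖ :=
  (norm_sub_le _ _).trans (by gcongr; exact norm_posteriorMean_le hp c s y)

lemma posteriorMean_smul_add (hp : 0 < p) (c : ι → E) (s : ℝ) (x : E) (i : ι) :
    posteriorMean p c s (s • c i + x) = c i + meanDisplacement p (fun j => c j - c i) s x := by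
  rw [posteriorMean, funext (channelLLR_smul_add c s x i), gibbsMean_add_const, meanDisplacement,
    gibbsMean_sub_const hp, add_sub_cancel]

variable [FiniteDimensional ℝ E] [MeasurableSpace E]

/-- The mean squared error of the posterior mean over the channel with amplitude `s`, for the
codebook `c` with prior `p`. -/
noncomputable def bayesError (p : ι → ℝ) (c : ι → E) (s : ℝ) : ℝ :=
  ∑ i, p i * ∫ x, ‖c i - posteriorMean p c s (s • c i + x)‖ ^ 2 ∂(stdGaussian E)

lemma bayesError_nonneg (hp : 0 ≤ p) (c : ι → E) (s : ℝ) : 0 ≤ bayesError p c s :=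
  Finset.sum_nonneg fun i _ => mul_nonneg (hp i) (integral_nonneg fun _ => sq_nonneg _)

lemma bayesError_eq_sum_codewordError (hp : 0 < p) (c : ι → E) (s : ℝ) :
    bayesError p c s = ∑ i, p i * codewordError p (fun j => c j - c i) s := by
  simp only [bayesError, codewordError, posteriorMean_smul_add hp, sub_add_cancel_left, norm_neg]

variable [BorelSpace E]

@[fun_prop]
lemma measurable_posteriorMean (c : ι → E) :
    Measurable fun q : (ι → ℝ) × ℝ × E => posteriorMean q.1 c q.2.1 q.2.2 :=
  (measurable_gibbsMean c).comp
    (measurable_fst.prodMk ((continuous_channelLLR c).measurable.comp measurable_snd))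

lemma measurable_bayesError (c : ι → E) :
    Measurable fun q : (ι → ℝ) × ℝ => bayesError q.1 c q.2 := by
  unfold bayesError
  refine Finset.measurable_sum _ fun i _ => .mul (by fun_prop) ?_
  exact (Measurable.stronglyMeasurable (by fun_prop)).integral_prod_right.measurable

lemma integrableOn_mul_codewordError_sqrt (hp : p ∈ stdSimplex ℝ ι) (hc : c.Injective) (i : ι) :
    IntegrableOn (fun γ => p i * codewordError p (fun j => c j - c i) √γ) (Ioi 0) := by
  rcases (hp.1 i).eq_or_lt with hi | hi
  · simp [← hi]
  · exact (integrableOn_codewordError_sqrt hp hi fun j => sub_eq_zero.trans hc.eq_iff).const_mul _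

lemma integral_mul_codewordError_sqrt (hp : p ∈ stdSimplex ℝ ι) (hc : c.Injective) (i : ι) :
    ∫ γ in Ioi 0, p i * codewordError p (fun j => c j - c i) √γ = 2 * Real.negMulLog (p i) := by
  rcases (hp.1 i).eq_or_lt with hi | hi
  · simp [← hi]
  · rw [integral_const_mul,
      integral_codewordError_sqrt hp hi fun j => sub_eq_zero.trans hc.eq_iff, Real.negMulLog]
    ring

lemma integrableOn_bayesError_sqrt (hp : p ∈ stdSimplex ℝ ι) (hc : c.Injective) :
    IntegrableOn (fun γ => bayesError p c √γ) (Ioi 0) := by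
  simp only [bayesError_eq_sum_codewordError (pos_of_mem_stdSimplex hp)]
  exact integrable_finsetSum _ fun i _ => integrableOn_mul_codewordError_sqrt hp hc i

lemma integral_bayesError_sqrt (hp : p ∈ stdSimplex ℝ ι) (hc : c.Injective) :
    ∫ γ in Ioi 0, bayesError p c √γ = 2 * ∑ i, Real.negMulLog (p i) := by
  simp only [bayesError_eq_sum_codewordError (pos_of_mem_stdSimplex hp)]
  rw [integral_finsetSum _ fun i _ => integrableOn_mul_codewordError_sqrt hp hc i, Finset.mul_sum]
  exact Finset.sum_congr rfl fun i _ => integral_mul_codewordError_sqrt hp hc i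

-- Moving the noise by the codeword tilts the Gaussian measure by `exp (channelLLR c s y i)`, so the
-- sum over `i` vanishes pointwise in `y`.
lemma sum_smul_integral_indicator_sub_posteriorMean (hp : 0 ≤ p) (c : ι → E) (s : ℝ) {B : Set E}
    (hB : MeasurableSet B) :
    ∑ i, p i • ∫ x, B.indicator (fun y => c i - posteriorMean p c s y) (s • c i + x)
      ∂(stdGaussian E) = 0 := by
  have hmeas (i : ι) : Measurable (B.indicator fun y => c i - posteriorMean p c s y) :=
    Measurable.indicator (by fun_prop) hB
  have hint (i : ι) : Integrable
      (fun y => Real.exp (channelLLR c s y i) •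
        B.indicator (fun y => c i - posteriorMean p c s y) y) (stdGaussian E) :=
    integrable_exp_gaussianLLR_smul (.of_bound (C := ‖c i‖ + ∑ j, ‖c j‖)
      ((hmeas i).comp (measurable_const_add _)).aestronglyMeasurable
      (ae_of_all _ fun x => (norm_indicator_le_norm_self _ _).trans
        (norm_sub_posteriorMean_le hp c s _ i)))
  calc ∑ i, p i • ∫ x, B.indicator (fun y => c i - posteriorMean p c s y) (s • c i + x)
        ∂(stdGaussian E)
      = ∑ i, p i • ∫ y, Real.exp (channelLLR c s y i) •
          B.indicator (fun y => c i - posteriorMean p c s y) y ∂(stdGaussian E) := by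
        simp only [integral_comp_add_left_stdGaussian, channelLLR]
    _ = ∫ y, ∑ i, p i • Real.exp (channelLLR c s y i) •
          B.indicator (fun y => c i - posteriorMean p c s y) y ∂(stdGaussian E) := by
        rw [integral_finsetSum _ fun i _ => (hint i).fun_smul (p i)]
        simp only [integral_smul]
    _ = ∫ _, 0 ∂(stdGaussian E) := by
        refine integral_congr_ae (ae_of_all _ fun y => ?_)
        by_cases hy : y ∈ B
        · simpa [hy, smul_smul, posteriorMean] using sum_smul_sub_gibbsMean hp (channelLLR c s y) c
        · simp [hy]
    _ = 0 := integral_zero _ _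

end Posterior

section DiscreteLaw

variable {S : Type*} [MeasurableSpace S] {C : Finset S} {ν : Measure S}

/-- The probability vector, indexed by `C`, of a measure concentrated on the finite set `C`. -/
noncomputable def pointMass (C : Finset S) (ν : Measure S) (c : C) : ℝ := ν.real {(c : S)}

lemma pointMass_nonneg (C : Finset S) (ν : Measure S) : 0 ≤ pointMass C ν :=
  fun _ => measureReal_nonneg

lemma entropyBits_eq_sum_pointMass (hν : ∀ᵐ x ∂ν, x ∈ C) :
    entropyBits ν = (∑ c : C, Real.negMulLog (pointMass C ν c)) / Real.log 2 := by
  have hzero (x : S) (hx : x ∉ C) : ν {x} = 0 :=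
    measure_mono_null (Set.singleton_subset_iff.2 hx) hν
  rw [entropyBits, tsum_eq_sum (s := C) fun x hx => by simp [Measure.real, hzero x hx],
    ← Finset.sum_coe_sort]
  rfl

variable [MeasurableSingletonClass S]

lemma measurable_pointMass (C : Finset S) : Measurable (pointMass C) :=
  measurable_pi_lambda _ fun _ =>
    (Measure.measurable_coe (measurableSet_singleton _)).ennreal_toReal

lemma integral_eq_sum_pointMass_smul [IsFiniteMeasure ν] {F : Type*} [NormedAddCommGroup F]
    [NormedSpace ℝ F] [CompleteSpace F] (hν : ∀ᵐ x ∂ν, x ∈ C) (f : S → F) :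
    ∫ x, f x ∂ν = ∑ c : C, pointMass C ν c • f c := by
  conv_lhs => rw [← Measure.restrict_eq_self_of_ae_mem (s := (C : Set S)) hν]
  rw [setIntegral_finset _ .finset, ← Finset.sum_coe_sort]
  rfl

lemma pointMass_mem_stdSimplex [IsProbabilityMeasure ν] (hν : ∀ᵐ x ∂ν, x ∈ C) :
    pointMass C ν ∈ stdSimplex ℝ C :=
  ⟨pointMass_nonneg C ν, by simpa using (integral_eq_sum_pointMass_smul hν fun _ => (1 : ℝ)).symm⟩

end DiscreteLaw

section ConditionalLaw

variable {S Ω F : Type*} [MeasurableSpace S] [StandardBorelSpace S] [Nonempty S]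
  [MeasurableSpace Ω] [MeasurableSpace F] {C : Finset S}
  {μ : Measure Ω} [IsFiniteMeasure μ] {X : Ω → S} {Z : Ω → F}

/-- The conditional probabilities `μ(X = c | Z = z)` of the elements `c` of `C`. -/
noncomputable def condPointMass (C : Finset S) (X : Ω → S) (Z : Ω → F) (μ : Measure Ω)
    [IsFiniteMeasure μ] (z : F) : C → ℝ :=
  pointMass C (condDistrib X Z μ z)

lemma condPointMass_nonneg (C : Finset S) (X : Ω → S) (Z : Ω → F) (μ : Measure Ω)
    [IsFiniteMeasure μ] (z : F) : 0 ≤ condPointMass C X Z μ z :=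
  pointMass_nonneg C _

@[fun_prop]
lemma measurable_condPointMass (C : Finset S) (X : Ω → S) (Z : Ω → F) (μ : Measure Ω)
    [IsFiniteMeasure μ] : Measurable (condPointMass C X Z μ) :=
  (measurable_pointMass C).comp (condDistrib X Z μ).measurable

lemma ae_ae_mem_condDistrib (hX : AEMeasurable X μ) (hZ : AEMeasurable Z μ)
    (hXC : ∀ᵐ ω ∂μ, X ω ∈ C) : ∀ᵐ z ∂(μ.map Z), ∀ᵐ x ∂(condDistrib X Z μ z), x ∈ C := by
  refine Measure.ae_ae_of_ae_compProd (p := fun y => y.2 ∈ C) ?_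
  rw [compProd_map_condDistrib hX]
  exact (ae_map_iff (hZ.prodMk hX) (measurable_snd C.measurableSet)).2 hXC

end ConditionalLaw

section Conditioning

variable {Ω α β : Type*} [MeasurableSpace Ω] [MeasurableSpace α] [MeasurableSpace β]
  {μ : Measure Ω} {U : Ω → α} {V : Ω → β} {B : Set β}

lemma cond_preimage_apply_of_indepFun [IsFiniteMeasure μ] (h : IndepFun U V μ) (hV : Measurable V)
    (hB : MeasurableSet B) (hμB : μ (V ⁻¹' B) ≠ 0) {A : Set α} (hA : MeasurableSet A) :
    μ[U ⁻¹' A | V ⁻¹' B] = μ (U ⁻¹' A) := by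
  rw [cond_apply (hV hB), inter_comm, h.measure_inter_preimage_eq_mul _ _ hA hB, mul_comm,
    mul_assoc, ENNReal.mul_inv_cancel hμB (measure_ne_top _ _), mul_one]

lemma map_cond_preimage_of_indepFun [IsFiniteMeasure μ] (h : IndepFun U V μ) (hU : Measurable U)
    (hV : Measurable V) (hB : MeasurableSet B) (hμB : μ (V ⁻¹' B) ≠ 0) :
    (μ[|V ⁻¹' B]).map U = μ.map U := by
  ext A hA
  rw [Measure.map_apply hU hA, Measure.map_apply hU hA,
    cond_preimage_apply_of_indepFun h hV hB hμB hA]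

lemma indepFun_cond_preimage [IsFiniteMeasure μ] (h : IndepFun U V μ) (hV : Measurable V)
    (hB : MeasurableSet B) (hμB : μ (V ⁻¹' B) ≠ 0) : IndepFun U V μ[|V ⁻¹' B] := by
  refine indepFun_iff_measure_inter_preimage_eq_mul.2 fun A A' hA hA' => ?_
  rw [cond_preimage_apply_of_indepFun h hV hB hμB hA, cond_apply (hV hB), cond_apply (hV hB),
    inter_left_comm, ← preimage_inter, h.measure_inter_preimage_eq_mul _ _ hA (hB.inter hA')]
  ring

end Conditioning

section SideInformation

variable {E : Type*} [NormedAddCommGroup E] [InnerProductSpace ℝ E] [FiniteDimensional ℝ E]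
  [MeasurableSpace E] {Ω F : Type*} [MeasurableSpace Ω] [MeasurableSpace F]

/-- The Bayes estimate, from the channel output and the side information, of an input with the same
conditional law given the side information as `X` given `Z`, for the codebook `C`. -/
noncomputable def bayesEstimator (C : Finset E) (X : Ω → E) (Z : Ω → F) (μ : Measure Ω)
    [IsFiniteMeasure μ] [BorelSpace E] (s : ℝ) (w : E × F) : E :=
  posteriorMean (condPointMass C X Z μ w.2) (↑) s w.1

/-- Under `Q`, the input `X` is a codeword of `C` and the standard Gaussian noise `N` is independent
of the input together with the side information `Z`. The channel output is `s • X + N`, for an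
arbitrary amplitude `s`. -/
structure IsGaussianChannel (C : Finset E) (X N : Ω → E) (Z : Ω → F) (Q : Measure Ω) : Prop where
  measurable_input : Measurable X
  measurable_noise : Measurable N
  measurable_sideInfo : Measurable Z
  input_mem : ∀ᵐ ω ∂Q, X ω ∈ C
  map_noise : Q.map N = stdGaussian E
  indepFun : IndepFun N (fun ω => (X ω, Z ω)) Q

/-- The mean squared error `E[|X - E[X | W]|²]` of the best estimate of `X` from `W`. -/
noncomputable def mmse (X : Ω → E) (W : Ω → F) (μ : Measure Ω) : ℝ :=
  ∫ ω, ‖X ω - (μ[X | MeasurableSpace.comap W inferInstance]) ω‖ ^ 2 ∂μ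

variable {C : Finset E} {X N : Ω → E} {Z : Ω → F} {Q : Measure Ω}

@[fun_prop]
lemma measurable_bayesEstimator [BorelSpace E] [IsFiniteMeasure Q] (C : Finset E) (X : Ω → E)
    (Z : Ω → F) (s : ℝ) : Measurable (bayesEstimator C X Z Q s) := by
  unfold bayesEstimator
  fun_prop

namespace IsGaussianChannel

lemma ae_norm_input_le (h : IsGaussianChannel C X N Z Q) : ∀ᵐ ω ∂Q, ‖X ω‖ ≤ ∑ c : C, ‖(c : E)‖ := by
  filter_upwards [h.input_mem] with ω hω
  exact Finset.single_le_sum (f := fun c : C => ‖(c : E)‖) (fun _ _ => norm_nonneg _)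
    (Finset.mem_univ ⟨X ω, hω⟩)

variable [BorelSpace E]

lemma of_cond {P : Measure Ω} [IsFiniteMeasure P] (hX : Measurable X) (hN : Measurable N)
    (hZ : Measurable Z) (hXC : P (X ⁻¹' C) ≠ 0) (hNlaw : P.map N = stdGaussian E)
    (hindep : IndepFun N (fun ω => (X ω, Z ω)) P) :
    IsGaussianChannel C X N Z (P[|X ⁻¹' C]) :=
  have hV : Measurable fun ω => (X ω, Z ω) := hX.prodMk hZ
  have hB : MeasurableSet (Prod.fst ⁻¹' C : Set (E × F)) := measurable_fst C.measurableSet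
  have hpre : X ⁻¹' C = (fun ω => (X ω, Z ω)) ⁻¹' (Prod.fst ⁻¹' C) := rfl
  { measurable_input := hX
    measurable_noise := hN
    measurable_sideInfo := hZ
    input_mem := ae_cond_mem (hX C.measurableSet)
    map_noise := by
      rw [← hNlaw, hpre, map_cond_preimage_of_indepFun hindep hN hV hB hXC]
    indepFun := by
      rw [hpre]
      exact indepFun_cond_preimage hindep hV hB hXC }

lemma measurable_output_sideInfo (h : IsGaussianChannel C X N Z Q) (s : ℝ) :
    Measurable fun ω => (s • X ω + N ω, Z ω) :=
  ((h.measurable_input.const_smul s).add h.measurable_noise).prodMk h.measurable_sideInfo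

variable [IsProbabilityMeasure Q]

lemma integrable_input (h : IsGaussianChannel C X N Z Q) : Integrable X Q :=
  .of_bound h.measurable_input.aestronglyMeasurable _ h.ae_norm_input_le

lemma map_prodMk (h : IsGaussianChannel C X N Z Q) :
    Q.map (fun ω => ((Z ω, X ω), N ω)) =
      (Q.map Z ⊗ₘ condDistrib X Z Q).prod (stdGaussian E) := by
  have hindep : IndepFun (fun ω => (Z ω, X ω)) N Q :=
    (h.indepFun.comp measurable_id measurable_swap).symm
  rw [hindep.map_prod_eq_prod_map_map (h.measurable_sideInfo.prodMk h.measurable_input).aemeasurable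
    h.measurable_noise.aemeasurable, h.map_noise, compProd_map_condDistrib
    h.measurable_input.aemeasurable]

lemma integral_eq_integral_sum_pointMass_smul {G : Type*} [NormedAddCommGroup G] [NormedSpace ℝ G]
    [CompleteSpace G] (h : IsGaussianChannel C X N Z Q) {f : F → E → E → G}
    (hf : StronglyMeasurable fun q : (F × E) × E => f q.1.1 q.1.2 q.2)
    (hi : Integrable (fun ω => f (Z ω) (X ω) (N ω)) Q) :
    ∫ ω, f (Z ω) (X ω) (N ω) ∂Q = ∫ z, ∑ c : C, condPointMass C X Z Q z c •
      ∫ x, f z c x ∂(stdGaussian E) ∂(Q.map Z) := by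
  have hm : AEMeasurable (fun ω => ((Z ω, X ω), N ω)) Q :=
    ((h.measurable_sideInfo.prodMk h.measurable_input).prodMk h.measurable_noise).aemeasurable
  have hi' := (integrable_map_measure hf.aestronglyMeasurable hm).2 hi
  rw [h.map_prodMk] at hi'
  calc ∫ ω, f (Z ω) (X ω) (N ω) ∂Q
      = ∫ q, f q.1.1 q.1.2 q.2 ∂((Q.map Z ⊗ₘ condDistrib X Z Q).prod (stdGaussian E)) := by
        rw [← h.map_prodMk, integral_map hm hf.aestronglyMeasurable]
    _ = ∫ z, ∫ c, ∫ x, f z c x ∂(stdGaussian E) ∂(condDistrib X Z Q z) ∂(Q.map Z) := by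
        rw [integral_prod _ hi', Measure.integral_compProd hi'.integral_prod_left]
    _ = _ := by
        refine integral_congr_ae ?_
        filter_upwards [ae_ae_mem_condDistrib h.measurable_input.aemeasurable
          h.measurable_sideInfo.aemeasurable h.input_mem] with z hz
        exact integral_eq_sum_pointMass_smul hz _

lemma ae_norm_input_sub_bayesEstimator_le (h : IsGaussianChannel C X N Z Q) (s : ℝ) :
    ∀ᵐ ω ∂Q, ‖X ω - bayesEstimator C X Z Q s (s • X ω + N ω, Z ω)‖ ≤
      2 * ∑ c : C, ‖(c : E)‖ := by
  filter_upwards [h.ae_norm_input_le] with ω hω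
  rw [two_mul]
  exact (norm_sub_le _ _).trans
    (add_le_add hω (norm_posteriorMean_le (condPointMass_nonneg C X Z Q _) _ s _))

lemma integrable_input_sub_bayesEstimator (h : IsGaussianChannel C X N Z Q) (s : ℝ) :
    Integrable (fun ω => X ω - bayesEstimator C X Z Q s (s • X ω + N ω, Z ω)) Q :=
  .of_bound (h.measurable_input.sub ((measurable_bayesEstimator C X Z s).comp
    (h.measurable_output_sideInfo s))).aestronglyMeasurable _
    (h.ae_norm_input_sub_bayesEstimator_le s)

lemma setIntegral_input_sub_bayesEstimator (h : IsGaussianChannel C X N Z Q) (s : ℝ)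
    {A : Set (E × F)} (hA : MeasurableSet A) :
    ∫ ω in (fun ω => (s • X ω + N ω, Z ω)) ⁻¹' A,
      (X ω - bayesEstimator C X Z Q s (s • X ω + N ω, Z ω)) ∂Q = 0 := by
  let err (z : F) (x y : E) : E :=
    {y | (y, z) ∈ A}.indicator (fun y => x - bayesEstimator C X Z Q s (y, z)) (s • x + y)
  have hout : Measurable fun q : (F × E) × E => (s • q.1.2 + q.2, q.1.1) := by fun_prop
  have herr : StronglyMeasurable fun q : (F × E) × E => err q.1.1 q.1.2 q.2 :=
    (Measurable.indicator (by fun_prop) (hout hA)).stronglyMeasurable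
  have hmeas := h.measurable_output_sideInfo s hA
  rw [← integral_indicator hmeas]
  refine (h.integral_eq_integral_sum_pointMass_smul (f := err) herr
    ((h.integrable_input_sub_bayesEstimator s).indicator hmeas)).trans ?_
  refine integral_eq_zero_of_ae (ae_of_all _ fun z => ?_)
  exact sum_smul_integral_indicator_sub_posteriorMean (condPointMass_nonneg C X Z Q z)
    (↑) s (hA.preimage measurable_prodMk_right)

lemma condExp_ae_eq_bayesEstimator (h : IsGaussianChannel C X N Z Q) (s : ℝ) :
    Q[X | MeasurableSpace.comap (fun ω => (s • X ω + N ω, Z ω)) inferInstance] =ᵐ[Q]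
      fun ω => bayesEstimator C X Z Q s (s • X ω + N ω, Z ω) := by
  have hest : Integrable (fun ω => bayesEstimator C X Z Q s (s • X ω + N ω, Z ω)) Q :=
    (h.integrable_input.sub (h.integrable_input_sub_bayesEstimator s)).congr
      (ae_of_all _ fun _ => sub_sub_cancel _ _)
  refine (ae_eq_condExp_of_forall_setIntegral_eq (h.measurable_output_sideInfo s).comap_le
    h.integrable_input (fun _ _ _ => hest.integrableOn) ?_ ((measurable_bayesEstimator C X Z
      s).comp (comap_measurable _)).stronglyMeasurable.aestronglyMeasurable).symm
  rintro _ ⟨A, hA, rfl⟩ -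
  rw [eq_comm, ← sub_eq_zero, ← integral_sub h.integrable_input.integrableOn hest.integrableOn]
  exact h.setIntegral_input_sub_bayesEstimator s hA

lemma mmse_eq_integral_bayesError (h : IsGaussianChannel C X N Z Q) (s : ℝ) :
    mmse X (fun ω => (s • X ω + N ω, Z ω)) Q =
      ∫ z, bayesError (condPointMass C X Z Q z) ((↑) : C → E) s ∂(Q.map Z) := by
  let err (z : F) (x y : E) : ℝ := ‖x - bayesEstimator C X Z Q s (s • x + y, z)‖ ^ 2
  have herr : StronglyMeasurable fun q : (F × E) × E => err q.1.1 q.1.2 q.2 :=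
    Measurable.stronglyMeasurable (by fun_prop)
  have hint : Integrable (fun ω => err (Z ω) (X ω) (N ω)) Q := by
    refine .of_bound ((h.integrable_input_sub_bayesEstimator s).aestronglyMeasurable.norm.pow 2)
      ((2 * ∑ c : C, ‖(c : E)‖) ^ 2) ?_
    filter_upwards [h.ae_norm_input_sub_bayesEstimator_le s] with ω hω
    rw [norm_pow, norm_norm]
    gcongr
  calc mmse X (fun ω => (s • X ω + N ω, Z ω)) Q
      = ∫ ω, err (Z ω) (X ω) (N ω) ∂Q := by
        refine integral_congr_ae ?_
        filter_upwards [h.condExp_ae_eq_bayesEstimator s] with ω hω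
        rw [hω]
    _ = ∫ z, bayesError (condPointMass C X Z Q z) ((↑) : C → E) s ∂(Q.map Z) :=
        h.integral_eq_integral_sum_pointMass_smul herr hint

end IsGaussianChannel

section Fubini

variable [BorelSpace E] [IsProbabilityMeasure Q]

lemma integrable_sum_negMulLog_condPointMass (C : Finset E) (X : Ω → E) (Z : Ω → F) :
    Integrable (fun z => ∑ c, Real.negMulLog (condPointMass C X Z Q z c)) (Q.map Z) := by
  refine integrable_finsetSum _ fun c _ => .of_bound (C := 1) ?_ (ae_of_all _ fun z => ?_)
  · exact (Measurable.comp Real.continuous_negMulLog.measurable (by fun_prop)).aestronglyMeasurable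
  · have h0 : 0 ≤ condPointMass C X Z Q z c := condPointMass_nonneg C X Z Q z c
    have h1 : condPointMass C X Z Q z c ≤ 1 := measureReal_le_one
    rw [Real.norm_of_nonneg (Real.negMulLog_nonneg h0 h1)]
    linarith [Real.negMulLog_le_one_sub_self h0]

lemma integrable_uncurry_bayesError_sqrt (hX : Measurable X) (hZ : Measurable Z)
    (hXC : ∀ᵐ ω ∂Q, X ω ∈ C) :
    Integrable (Function.uncurry fun z γ => bayesError (condPointMass C X Z Q z) ((↑) : C → E) √γ)
      ((Q.map Z).prod (volume.restrict (Ioi 0))) := by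
  have hmeas : Measurable
      (Function.uncurry fun z γ => bayesError (condPointMass C X Z Q z) ((↑) : C → E) √γ) :=
    (measurable_bayesError ((↑) : C → E)).comp
      (f := fun q : F × ℝ => (condPointMass C X Z Q q.1, √q.2)) (by fun_prop)
  have hae := ae_ae_mem_condDistrib hX.aemeasurable hZ.aemeasurable hXC
  refine (integrable_prod_iff hmeas.aestronglyMeasurable).2 ⟨?_, ?_⟩
  · filter_upwards [hae] with z hz
    exact integrableOn_bayesError_sqrt (pointMass_mem_stdSimplex hz) Subtype.val_injective
  · refine ((integrable_sum_negMulLog_condPointMass C X Z).const_mul 2).congr ?_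
    filter_upwards [hae] with z hz
    rw [condPointMass, ← integral_bayesError_sqrt (pointMass_mem_stdSimplex hz)
      Subtype.val_injective]
    congr with γ
    exact (Real.norm_of_nonneg (bayesError_nonneg (pointMass_nonneg C _) _ _)).symm

lemma integral_integral_bayesError_sqrt (hX : Measurable X) (hZ : Measurable Z)
    (hXC : ∀ᵐ ω ∂Q, X ω ∈ C) :
    ∫ γ in Ioi 0, ∫ z, bayesError (condPointMass C X Z Q z) ((↑) : C → E) √γ ∂(Q.map Z) =
      Real.log 4 * condEntropyBits X Z Q := by
  rw [← integral_integral_swap (integrable_uncurry_bayesError_sqrt hX hZ hXC), condEntropyBits,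
    ← integral_const_mul]
  refine integral_congr_ae ?_
  filter_upwards [ae_ae_mem_condDistrib hX.aemeasurable hZ.aemeasurable hXC] with z hz
  have hlog4 : Real.log 4 = 2 * Real.log 2 := by
    rw [show (4 : ℝ) = 2 ^ 2 by norm_num, Real.log_pow, Nat.cast_ofNat]
  have hlog2 : Real.log 2 ≠ 0 := (Real.log_pos one_lt_two).ne'
  rw [condPointMass, integral_bayesError_sqrt (pointMass_mem_stdSimplex hz) Subtype.val_injective,
    entropyBits_eq_sum_pointMass hz, hlog4]
  field_simp

end Fubini

end SideInformation

end AreaProperty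

open AreaProperty in
theorem theorem1_general {E Ω 𝓩 : Type*} [NormedAddCommGroup E] [InnerProductSpace ℝ E]
    [FiniteDimensional ℝ E] [MeasurableSpace E] [BorelSpace E] [MeasurableSpace Ω]
    [MeasurableSpace 𝓩] (P : Measure Ω) [IsProbabilityMeasure P] (C : Set E) (hC : C.Finite)
    (X N : Ω → E) (Z : Ω → 𝓩) (hX : Measurable X) (hN : Measurable N) (hZ : Measurable Z)
    (hXC : P (X ⁻¹' C) ≠ 0) (hNlaw : P.map N = stdGaussian E)
    (hindep : IndepFun N (fun ω => (X ω, Z ω)) P) :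
    IntegrableOn (fun γ : ℝ => mmse X (fun ω => (√γ • X ω + N ω, Z ω)) (P[|X ⁻¹' C]))
      (Set.Ioi 0) ∧
    ∫ γ in Set.Ioi (0 : ℝ), mmse X (fun ω => (√γ • X ω + N ω, Z ω)) (P[|X ⁻¹' C]) =
      Real.log 4 * condEntropyBits X Z (P[|X ⁻¹' C]) := by
  obtain ⟨C, rfl⟩ := hC.exists_finset_coe
  have : IsProbabilityMeasure (P[|X ⁻¹' C]) := cond_isProbabilityMeasure hXC
  have h : IsGaussianChannel C X N Z (P[|X ⁻¹' C]) := .of_cond hX hN hZ hXC hNlaw hindep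
  simp only [h.mmse_eq_integral_bayesError]
  exact ⟨(integrable_uncurry_bayesError_sqrt hX hZ h.input_mem).integral_prod_right,
    integral_integral_bayesError_sqrt hX hZ h.input_mem⟩

theorem theorem1 {Ω 𝓩 : Type*} [MeasurableSpace Ω] [MeasurableSpace 𝓩]
    (P : Measure Ω) [IsProbabilityMeasure P]
    (n : ℕ) (hn : 0 < n)
    (C : Set (EuclideanSpace ℝ (Fin n))) (hC : C.Finite)
    (X N : Ω → EuclideanSpace ℝ (Fin n)) (Z : Ω → 𝓩)
    (hX : Measurable X) (hN : Measurable N) (hZ : Measurable Z)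
    (hXC : P (X ⁻¹' C) ≠ 0)
    (hNlaw : P.map N = stdGaussian (EuclideanSpace ℝ (Fin n)))
    (hindep : IndepFun N (fun ω => (X ω, Z ω)) P) :
    IntegrableOn
      (fun γ : ℝ => AreaProperty.avgMMSE X
        (fun ω => (AreaProperty.channelOutput γ X N ω, Z ω)) (P[|X ⁻¹' C]))
      (Set.Ioi 0) volume ∧
    ∫ γ in Set.Ioi (0 : ℝ), AreaProperty.avgMMSE X
        (fun ω => (AreaProperty.channelOutput γ X N ω, Z ω)) (P[|X ⁻¹' C])
      = Real.log 4 / (n : ℝ) * AreaProperty.condEntropyBits X Z (P[|X ⁻¹' C]) := by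
  obtain ⟨hint, heq⟩ := theorem1_general P C hC X N Z hX hN hZ hXC hNlaw hindep
  refine ⟨hint.const_mul (1 / (n : ℝ)), (integral_const_mul _ _).trans ?_⟩
  exact (congrArg (1 / (n : ℝ) * ·) heq).trans (by ring)
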